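/- Consider the following two-player concurrent stochastic game $\mathcal{G}$, the ``Bad Match''. Its states are $d, w, l, s, t$; in every state both players, Max and Min, have the action set $\{0,1\}$. At every step both players, independently and simultaneously, choose actions (possibly at random), and all transitions are deterministic: if Max plays $a$ and Min plays $b$ in state $d$, then the next state is $w$ if $(a,b)=(1,1)$, $l$ if $(a,b)=(1,0)$, $t$ if $(a,b)=(0,1)$, and $s$ if $(a,b)=(0,0)$; the states $w$ and $l$ are sinks (they are never left), and from $s$ and from $t$ the play returns to $d$, whatever the actions. Max's objective $\mathtt{Bu}$ is the Büchi objective: the set of plays that visit the target set $\{s,w\}$ infinitely often. A Max strategy $\sigma$ is finite-memory if it is based on a finite set $M$ of memory modes: it is given by an initial mode $m_0\in M$, a function that assigns to the current mode and state a distribution on Max's actions, and a function that assigns to the current state $s_n$, mode $m_n$, actions $a_n,b_n$ and next state $s_{n+1}$ a distribution on $M$, from which the next mode $m_{n+1}$ is drawn. The memory may be private, i.e., Min does not observe the modes. Let $\Pi$ be the set of all Min strategies, i.e., functions that assign to every finite history of states and actions a distribution on Min's actions, and let $\mathcal{P}_{\mathcal{G},d,\sigma,\pi}$ be the probability measure on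 plays that is induced by the initial state $d$ and the strategies $\sigma$ and $\pi\in\Pi$. Then every finite-memory Max strategy $\sigma$ in the Bad Match is worthless from $d$, i.e., $$\inf_{\pi\in\Pi}\mathcal{P}_{\mathcal{G},d,\sigma,\pi}(\mathtt{Bu})=0 .$$ Equivalently, for every $\varepsilon>0$ there is a Min strategy $\pi\in\Pi$ with $\mathcal{P}_{\mathcal{G},d,\sigma,\pi}(\mathtt{Bu})<\varepsilon$. -/

import Mathlib

open MeasureTheory ProbabilityTheory Filter
open scoped ENNReal

/-- A concurrent stochastic game with states `S` in which, at every state, Max has the action set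
`A` and Min has the action set `B`; `trans s a b` is the distribution of the successor state. -/
structure ConcurrentGame (S A B : Type*) where
  trans : S → A → B → PMF S

/-- A play, as the infinite sequence of its triples (state, Max action, Min action). -/
abbrev Play (S A B : Type*) := ℕ → S × A × B

/-- The Büchi objective: the plays that visit the target set `T` infinitely often. -/
def buchi {S A B : Type*} (T : Set S) : Set (Play S A B) :=
  {ω | ∃ᶠ n in atTop, (ω n).1 ∈ T}

/-- A general (history-dependent, randomized) Min strategy. The history at step `n` consists of
the `n` past triples (state, Max action, Min action) and of the current state. In particular Min
does not observe the memory modes of Max. -/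
abbrev MinStrategy (S A B : Type*) := (n : ℕ) → (Fin n → S × A × B) → S → PMF B

/-- A Max strategy based on the set `M` of memory modes: an initial mode, the choice of a mixed
action from the current mode and state, and the (possibly randomized) update of the mode from the
current state `s`, mode `m`, actions `a`, `b` and the next state `s'`, as `update s m a b s'`. -/
structure MemoryStrategy (M S A B : Type*) where
  init : M
  act : M → S → PMF A
  update : S → M → A → B → S → PMF M

/-- One step of the game together with Max's memory: the current memory mode and state,
and the actions that are played. -/
@[ext]
structure MemoryStep (M S A B : Type*) where
  mode : M
  state : S
  actMax : A
  actMin : B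

namespace MemoryStep

variable {M S A B : Type*}

/-- All sets of steps are measurable (the measures below are used for countably many steps). -/
instance : MeasurableSpace (MemoryStep M S A B) := ⊤

instance : DiscreteMeasurableSpace (MemoryStep M S A B) := ⟨fun _ => trivial⟩

/-- The triple (state, Max action, Min action), which forgets the memory mode. -/
def toTriple (x : MemoryStep M S A B) : S × A × B := (x.state, x.actMax, x.actMin)

instance [Countable M] [Countable S] [Countable A] [Countable B] :
    Countable (MemoryStep M S A B) :=
  Function.Injective.countable (f := fun x : MemoryStep M S A B => (x.mode, x.toTriple)) (by
    intro x y h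
    simp only [toTriple, Prod.mk.injEq] at h
    exact MemoryStep.ext h.1 h.2.1 h.2.2.1 h.2.2.2)

theorem measurable_forget
    [MeasurableSpace S] [MeasurableSpace A] [MeasurableSpace B] :
    Measurable fun (x : ℕ → MemoryStep M S A B) (n : ℕ) => (x n).toTriple :=
  measurable_pi_lambda _ fun n =>
    (Measurable.of_discrete (f := MemoryStep.toTriple (M := M) (S := S) (A := A) (B := B))).comp
      (measurable_pi_apply n)

end MemoryStep

noncomputable section

namespace ConcurrentGame

variable {M S A B : Type*}

/-- In state `s`, with Max in mode `m` and with past triples `h`, both players draw their actions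
independently. -/
def drawActions (σ : MemoryStrategy M S A B) (π : MinStrategy S A B)
    (n : ℕ) (h : Fin n → S × A × B) (m : M) (s : S) : PMF (MemoryStep M S A B) :=
  (σ.act m s).bind fun a => (π n h s).bind fun b => PMF.pure ⟨m, s, a, b⟩

/-- The law of step `n + 1`, given the steps `0, …, n`: first the next state `s'` is drawn from
the transition function, then Max's next mode `m'` from the update function, then the actions. -/
def nextStep (G : ConcurrentGame S A B) (σ : MemoryStrategy M S A B) (π : MinStrategy S A B)
    (n : ℕ) (x : (i : Finset.Iic n) → MemoryStep M S A B) : PMF (MemoryStep M S A B) :=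
  let y : MemoryStep M S A B := x ⟨n, Finset.mem_Iic.2 le_rfl⟩
  let h : Fin (n + 1) → S × A × B :=
    fun i => (x ⟨i, Finset.mem_Iic.2 (Nat.lt_succ_iff.1 i.2)⟩).toTriple
  (G.trans y.state y.actMax y.actMin).bind fun s' =>
    (σ.update y.state y.mode y.actMax y.actMin s').bind fun m' =>
      drawActions σ π (n + 1) h m' s'

variable [Countable M] [Countable S] [Countable A] [Countable B]

/-- `nextStep` as a Markov kernel. -/
def stepKernel (G : ConcurrentGame S A B) (σ : MemoryStrategy M S A B) (π : MinStrategy S A B)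
    (n : ℕ) : Kernel ((i : Finset.Iic n) → MemoryStep M S A B) (MemoryStep M S A B) :=
  Kernel.ofFunOfCountable fun x => (nextStep G σ π n x).toMeasure

instance (G : ConcurrentGame S A B) (σ : MemoryStrategy M S A B) (π : MinStrategy S A B)
    (n : ℕ) : IsMarkovKernel (stepKernel G σ π n) :=
  ⟨fun x => by
    change IsProbabilityMeasure (nextStep G σ π n x).toMeasure
    infer_instance⟩

/-- The law of the infinite sequence of steps, with Max's memory modes, from the state `s₀`
(the Ionescu-Tulcea measure). -/
def memoryLaw (G : ConcurrentGame S A B) (s₀ : S) (σ : MemoryStrategy M S A B)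
    (π : MinStrategy S A B) : Measure (ℕ → MemoryStep M S A B) :=
  Kernel.trajMeasure (X := fun _ => MemoryStep M S A B)
    (drawActions σ π 0 Fin.elim0 σ.init s₀).toMeasure (stepKernel G σ π)

instance (G : ConcurrentGame S A B) (s₀ : S) (σ : MemoryStrategy M S A B)
    (π : MinStrategy S A B) : IsProbabilityMeasure (memoryLaw G s₀ σ π) := by
  unfold memoryLaw
  infer_instance

variable [MeasurableSpace S] [MeasurableSpace A] [MeasurableSpace B]

/-- The probability measure on plays that the initial state `s₀`, the memory-based Max strategy
`σ` and the Min strategy `π` induce: the law of the play, where Max's memory is forgotten. -/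
def playLaw (G : ConcurrentGame S A B) (s₀ : S) (σ : MemoryStrategy M S A B)
    (π : MinStrategy S A B) : Measure (Play S A B) :=
  (memoryLaw G s₀ σ π).map fun x n => (x n).toTriple

instance (G : ConcurrentGame S A B) (s₀ : S) (σ : MemoryStrategy M S A B)
    (π : MinStrategy S A B) : IsProbabilityMeasure (playLaw G s₀ σ π) :=
  Measure.isProbabilityMeasure_map MemoryStep.measurable_forget.aemeasurable

end ConcurrentGame

/-- The states of the Bad Match. -/
inductive BadMatchState
  | d | w | l | s | t

namespace BadMatchState

instance : MeasurableSpace BadMatchState := ⊤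

instance : DiscreteMeasurableSpace BadMatchState := ⟨fun _ => trivial⟩

instance : Countable BadMatchState :=
  Function.Injective.countable (f := fun x : BadMatchState => x.ctorIdx) (by
    intro x y h
    cases x <;> cases y <;> first | rfl | cases h)

/-- The successor of each state under the actions of Max and Min. -/
def next : BadMatchState → Fin 2 → Fin 2 → BadMatchState
  | d, 1, 1 => w
  | d, 1, 0 => l
  | d, 0, 1 => t
  | d, 0, 0 => s
  | w, _, _ => w
  | l, _, _ => l
  | s, _, _ => d
  | t, _, _ => d

end BadMatchState

/-- The Bad Match: both players have the actions `0` and `1`, and all transitions are Dirac. -/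
def badMatch : ConcurrentGame BadMatchState (Fin 2) (Fin 2) where
  trans x a b := PMF.pure (x.next a b)

end

/-! Min can ignore the history and play a fixed 0-1 sequence that is eventually 1. Against such a
sequence `s` is visited only finitely often, so Büchi plays end in the sink `w`. It remains to make
the probability of `w` small, uniformly in late times. With finite memory, (mode, state) is a finite
chain driven by Min's bits.

`val` is an infimum of linear functionals, so it attains a maximum `v` on the compact set of
distributions avoiding `w` and `l`. Suppose `v > 0`. No first bit lowers `val`
(`val_le_val_vecMul`). Bit 0 sends no mass to `w`; were it to send mass to `l`, renormalizing the
rest would give a value above `v` (`mem_undecided_of_le`). So bit 0 loses nothing, which means that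
Max never risks action 1 at `d`, and bit 1 does not lead to `w` either. Hence bit 1 leads to another
maximizer (`vecMul_one_mem`). Iterating, constant 1 never reaches `w`, so `v ≤ 0`, a contradiction
(`val_nonpos`). -/

/-- The backward iteration `K (b 0) (K (b 1) (⋯ (K (b (n - 1)) g)))`. -/
def backwardIter {F : Type*} (K : Fin 2 → F → F) (b : ℕ → Fin 2) : ℕ → F → F
  | 0, g => g
  | n + 1, g => K (b 0) (backwardIter K (fun k => b (k + 1)) n g)

theorem backwardIter_succ_last {F : Type*} (K : Fin 2 → F → F) (b : ℕ → Fin 2) (n : ℕ) (g : F) :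
    backwardIter K b (n + 1) g = backwardIter K b n (K (b n) g) := by
  induction n generalizing b with
  | zero => rfl
  | succ n ih => rw [backwardIter, ih]; rfl

/-! ### Blind control of a finite Markov chain. -/

namespace BlindControl

open Matrix

variable {X : Type*} [Fintype X]

/-- The operators on functions that a pair of transition matrices induces. -/
def op (P : Fin 2 → Matrix X X ℝ) (β : Fin 2) (f : X → ℝ) : X → ℝ := P β *ᵥ f

/-- Two transition matrices, with a goal set `W` and an absorbing set `L`, such that `0` never leads
to `W`, and `1` does not lead to `W` from where `0` does not lead to `L`. -/
structure IsBlindControl (P : Fin 2 → Matrix X X ℝ) (W L : Set X) : Prop where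
  nonneg : ∀ β x y, 0 ≤ P β x y
  sum_eq_one : ∀ β x, ∑ y, P β x y = 1
  disjoint : ∀ x ∈ L, x ∉ W
  absorbing : ∀ β, ∀ x ∈ L, ∀ y ∉ L, P β x y = 0
  zero_avoids : ∀ x ∉ W, ∀ y ∈ W, P 0 x y = 0
  one_avoids : ∀ x ∉ W, x ∉ L → (∀ y ∈ L, P 0 x y = 0) → ∀ y ∈ W, P 1 x y = 0

/-- The bounds on the probability to be in `W` in the long run under some control sequence that is
eventually `1`. -/
def bounds (P : Fin 2 → Matrix X X ℝ) (W L : Set X) : Set (X → ℝ) :=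
  {f | (∀ x, 0 ≤ f x) ∧ (∀ x ∈ L, f x = 0) ∧ ∃ b : ℕ → Fin 2,
    ∀ᶠ n in atTop, b n = 1 ∧ ∀ x, backwardIter (op P) b n (W.indicator 1) x ≤ f x}

/-- The best bound from the initial distribution `α`. -/
noncomputable def val (P : Fin 2 → Matrix X X ℝ) (W L : Set X) (α : X → ℝ) : ℝ :=
  ⨅ f : bounds P W L, α ⬝ᵥ f.1

/-- The probability vectors that vanish on `W` and on `L`. -/
def undecided (W L : Set X) : Set (X → ℝ) :=
  {α | α ∈ stdSimplex ℝ X ∧ ∀ x, x ∈ W ∨ x ∈ L → α x = 0}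

variable {P : Fin 2 → Matrix X X ℝ} {W L : Set X}

namespace IsBlindControl

theorem op_mono (h : IsBlindControl P W L) (β : Fin 2) {f g : X → ℝ} (hfg : ∀ x, f x ≤ g x)
    (x : X) : op P β f x ≤ op P β g x :=
  Finset.sum_le_sum fun y _ => mul_le_mul_of_nonneg_left (hfg y) (h.nonneg β x y)

theorem op_nonneg (h : IsBlindControl P W L) (β : Fin 2) {f : X → ℝ} (hf : ∀ x, 0 ≤ f x)
    (x : X) : 0 ≤ op P β f x :=
  Finset.sum_nonneg fun y _ => mul_nonneg (h.nonneg β x y) (hf y)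

theorem op_eq_zero (h : IsBlindControl P W L) (β : Fin 2) {f : X → ℝ} (hf : ∀ x ∈ L, f x = 0)
    (x : X) (hx : x ∈ L) : op P β f x = 0 := by
  refine Finset.sum_eq_zero fun y _ => ?_
  by_cases hy : y ∈ L
  · simp [hf y hy]
  · simp [h.absorbing β x hx y hy]

/-- Prepending `β` to a control sequence keeps it eventually 1. -/
theorem op_mem_bounds (h : IsBlindControl P W L) (β : Fin 2) {f : X → ℝ} (hf : f ∈ bounds P W L) :
    op P β f ∈ bounds P W L := by
  obtain ⟨h0, hL, b, hb⟩ := hf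
  refine ⟨h.op_nonneg β h0, h.op_eq_zero β hL, fun n => Nat.casesOn n β b, ?_⟩
  obtain ⟨N, hN⟩ := eventually_atTop.1 hb
  filter_upwards [eventually_ge_atTop (N + 1)] with n hn
  obtain ⟨n, rfl⟩ : ∃ k, n = k + 1 := ⟨n - 1, by lia⟩
  have := hN n (by lia)
  exact ⟨this.1, h.op_mono β this.2⟩

theorem backwardIter_bounds (h : IsBlindControl P W L) (b : ℕ → Fin 2) (n : ℕ) :
    (∀ x, backwardIter (op P) b n (W.indicator 1) x ≤ 1) ∧
      (∀ x, 0 ≤ backwardIter (op P) b n (W.indicator 1) x) ∧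
      ∀ x ∈ L, backwardIter (op P) b n (W.indicator 1) x = 0 := by
  classical
  induction n generalizing b with
  | zero =>
    refine ⟨fun x => ?_, fun x => ?_, fun x hx => ?_⟩
    · simp only [backwardIter, Set.indicator_apply]; split_ifs <;> simp
    · simp only [backwardIter, Set.indicator_apply]; split_ifs <;> simp
    · simp [backwardIter, h.disjoint x hx]
  | succ n ih =>
    obtain ⟨h1, h2, h3⟩ := ih fun k => b (k + 1)
    refine ⟨fun x => (h.op_mono _ h1 x).trans ?_, h.op_nonneg _ h2, h.op_eq_zero _ h3⟩
    simp [op, mulVec, dotProduct, h.sum_eq_one]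

/-- The bound for the constant control 1: probabilities are at most 1, and they vanish from where
`W` is never reached. -/
theorem indicator_mem_bounds (h : IsBlindControl P W L) :
    ({x | ∃ n, 0 < backwardIter (op P) (fun _ => 1) n (W.indicator 1) x}.indicator 1 : X → ℝ) ∈
      bounds P W L := by
  classical
  refine ⟨fun x => Set.indicator_nonneg (fun _ _ => zero_le_one) x, fun x hx => ?_, fun _ => 1,
    Eventually.of_forall fun n => ⟨rfl, fun x => ?_⟩⟩
  · rw [Set.indicator_of_notMem]
    rintro ⟨n, hn⟩
    exact hn.ne' ((h.backwardIter_bounds _ n).2.2 x hx)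
  · by_cases hx : 0 < backwardIter (op P) (fun _ => 1) n (W.indicator 1) x
    · have hmem : x ∈ {x | ∃ n, 0 < backwardIter (op P) (fun _ => 1) n (W.indicator 1) x} := ⟨n, hx⟩
      rw [Set.indicator_of_mem hmem]
      exact (h.backwardIter_bounds _ n).1 x
    · exact (not_lt.1 hx).trans (Set.indicator_nonneg (fun _ _ => zero_le_one) x)

theorem val_le {α f : X → ℝ} (hα : ∀ x, 0 ≤ α x) (hf : f ∈ bounds P W L) :
    val P W L α ≤ α ⬝ᵥ f :=
  ciInf_le ⟨0, by
    rintro _ ⟨g, rfl⟩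
    exact Finset.sum_nonneg fun x _ => mul_nonneg (hα x) (g.2.1 x)⟩ (⟨f, hf⟩ : bounds P W L)

theorem le_val (h : IsBlindControl P W L) {α : X → ℝ} {c : ℝ}
    (hc : ∀ f ∈ bounds P W L, c ≤ α ⬝ᵥ f) : c ≤ val P W L α :=
  have : Nonempty (bounds P W L) := ⟨⟨_, h.indicator_mem_bounds⟩⟩
  le_ciInf fun f => hc f.1 f.2

theorem vecMul_mem_stdSimplex (h : IsBlindControl P W L) (β : Fin 2) {α : X → ℝ}
    (hα : α ∈ stdSimplex ℝ X) : α ᵥ* P β ∈ stdSimplex ℝ X := by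
  refine ⟨fun y => Finset.sum_nonneg fun x _ => mul_nonneg (hα.1 x) (h.nonneg β x y), ?_⟩
  simp only [vecMul, dotProduct]
  rw [Finset.sum_comm]
  simp [← Finset.mul_sum, h.sum_eq_one, hα.2]

theorem val_le_val_vecMul (h : IsBlindControl P W L) (β : Fin 2) {α : X → ℝ}
    (hα : α ∈ stdSimplex ℝ X) : val P W L α ≤ val P W L (α ᵥ* P β) :=
  h.le_val fun f hf => by
    rw [← dotProduct_mulVec]
    exact val_le hα.1 (h.op_mem_bounds β hf)

/-- Mass on `L` contributes nothing to any bound. If only mass `c` lies outside `L`, rescaling it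
multiplies the value by `c⁻¹`, so maximality of `v` forces `c = 1`. -/
theorem mem_undecided_of_le (h : IsBlindControl P W L) {v : ℝ} (hv : 0 < v)
    (hmax : ∀ α ∈ undecided W L, val P W L α ≤ v) {α : X → ℝ} (hα : α ∈ stdSimplex ℝ X)
    (hW : ∀ x ∈ W, α x = 0) (hle : v ≤ val P W L α) : α ∈ undecided W L := by
  classical
  set c : ℝ := ∑ x, Lᶜ.indicator α x with hc
  have hind : ∀ x, 0 ≤ Lᶜ.indicator α x := fun x =>
    Set.indicator_nonneg (fun y _ => hα.1 y) x
  have hc0 : 0 ≤ c := Finset.sum_nonneg fun x _ => hind x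
  have hdot : ∀ f ∈ bounds P W L, α ⬝ᵥ f = Lᶜ.indicator α ⬝ᵥ f := fun f hf => by
    refine Finset.sum_congr rfl fun x _ => ?_
    by_cases hx : x ∈ L
    · simp [hf.2.1 x hx]
    · simp [hx]
  -- If all mass lay in `L`, every bound would integrate to 0, against `0 < v`.
  have hcpos : 0 < c := by
    refine hc0.lt_of_ne fun hc1 => ?_
    have hz := (Finset.sum_eq_zero_iff_of_nonneg fun x _ => hind x).1 hc1.symm
    have := hle.trans (val_le hα.1 h.indicator_mem_bounds)
    rw [hdot _ h.indicator_mem_bounds, dotProduct,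
      Finset.sum_eq_zero fun x hx => by rw [hz x hx, zero_mul]] at this
    linarith
  have hγ : c⁻¹ • Lᶜ.indicator α ∈ undecided W L := by
    refine ⟨⟨fun x => mul_nonneg (inv_nonneg.2 hc0) (hind x), ?_⟩, fun x hx => ?_⟩
    · simp only [Pi.smul_apply, smul_eq_mul, ← Finset.mul_sum]
      rw [← hc, inv_mul_cancel₀ hcpos.ne']
    · rcases hx with hx | hx
      · simp [Set.indicator_apply, hW x hx]
      · simp [hx]
  have hval : c⁻¹ * v ≤ val P W L (c⁻¹ • Lᶜ.indicator α) := h.le_val fun f hf => by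
    rw [smul_dotProduct, smul_eq_mul, ← hdot f hf]
    exact mul_le_mul_of_nonneg_left (hle.trans (val_le hα.1 hf)) (inv_nonneg.2 hc0)
  have hc1 : 1 ≤ c := by
    have := hval.trans (hmax _ hγ)
    rw [inv_mul_le_iff₀ hcpos] at this
    nlinarith
  have hsum : ∑ x, L.indicator α x = 0 := by
    have h1 : ∑ x, L.indicator α x + c = 1 := by
      rw [hc, ← Finset.sum_add_distrib, ← hα.2]
      exact Finset.sum_congr rfl fun x _ => congrFun (Set.indicator_self_add_compl L α) x
    have h2 : 0 ≤ ∑ x, L.indicator α x := Finset.sum_nonneg fun x _ =>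
      Set.indicator_nonneg (fun y _ => hα.1 y) x
    linarith
  refine ⟨hα, fun x hx => hx.elim (hW x) fun hxL => ?_⟩
  have := (Finset.sum_eq_zero_iff_of_nonneg fun x _ =>
    Set.indicator_nonneg (fun y _ => hα.1 y) x).1 hsum x (Finset.mem_univ x)
  rwa [Set.indicator_of_mem hxL] at this

theorem vecMul_one_mem (h : IsBlindControl P W L) {v : ℝ} (hv : 0 < v)
    (hmax : ∀ α ∈ undecided W L, val P W L α ≤ v) {α : X → ℝ} (hα : α ∈ undecided W L)
    (hle : v ≤ val P W L α) : α ᵥ* P 1 ∈ undecided W L ∧ v ≤ val P W L (α ᵥ* P 1) := by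
  have h0 : α ᵥ* P 0 ∈ undecided W L := by
    refine h.mem_undecided_of_le hv hmax (h.vecMul_mem_stdSimplex 0 hα.1) (fun y hy => ?_)
      (hle.trans (h.val_le_val_vecMul 0 hα.1))
    refine Finset.sum_eq_zero fun x _ => ?_
    by_cases hx : x ∈ W
    · simp [hα.2 x (.inl hx)]
    · simp [h.zero_avoids x hx y hy]
  have h1 := hle.trans (h.val_le_val_vecMul 1 hα.1)
  refine ⟨h.mem_undecided_of_le hv hmax (h.vecMul_mem_stdSimplex 1 hα.1) (fun y hy => ?_) h1, h1⟩
  refine Finset.sum_eq_zero fun x _ => ?_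
  by_cases hx : α x = 0
  · simp [hx]
  · have hxW : x ∉ W := fun hxW => hx (hα.2 x (.inl hxW))
    have hxL : x ∉ L := fun hxL => hx (hα.2 x (.inr hxL))
    -- Since `α ᵥ* P 0` has no mass on `L`, control 0 does not lead to `L` from any point of the
    -- support of `α`.
    refine mul_eq_zero_of_right _ (h.one_avoids x hxW hxL (fun z hz => ?_) y hy)
    have := (Finset.sum_eq_zero_iff_of_nonneg fun x _ =>
      mul_nonneg (hα.1.1 x) (h.nonneg 0 x z)).1 (h0.2 z (.inr hz)) x (Finset.mem_univ x)
    exact (mul_eq_zero.1 this).resolve_left hx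

theorem dotProduct_backwardIter_one (h : IsBlindControl P W L) {v : ℝ} (hv : 0 < v)
    (hmax : ∀ α ∈ undecided W L, val P W L α ≤ v) (n : ℕ) {α : X → ℝ} (hα : α ∈ undecided W L)
    (hle : v ≤ val P W L α) :
    α ⬝ᵥ backwardIter (op P) (fun _ => 1) n (W.indicator 1) = 0 := by
  classical
  induction n generalizing α with
  | zero =>
    refine Finset.sum_eq_zero fun x _ => ?_
    by_cases hx : x ∈ W
    · simp [hα.2 x (.inl hx)]
    · simp [backwardIter, hx]
  | succ n ih =>
    have := h.vecMul_one_mem hv hmax hα hle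
    rw [backwardIter, op, dotProduct_mulVec]
    exact ih this.1 this.2

theorem isCompact_undecided : IsCompact (undecided W L) := by
  have : undecided W L = stdSimplex ℝ X ∩ ⋂ x, ⋂ _ : x ∈ W ∨ x ∈ L, {α : X → ℝ | α x = 0} := by
    ext α; simp [undecided]
  rw [this]
  exact (isCompact_stdSimplex ℝ X).inter_right (isClosed_iInter fun x => isClosed_iInter fun _ =>
    isClosed_eq (continuous_apply x) continuous_const)

theorem val_nonpos (h : IsBlindControl P W L) {α : X → ℝ} (hα : α ∈ undecided W L) :
    val P W L α ≤ 0 := by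
  classical
  -- An infimum of continuous functions; upper semicontinuity suffices for a maximum on a compact
  -- set.
  have husc : UpperSemicontinuousOn (val P W L) (undecided W L) :=
    upperSemicontinuousOn_ciInf (fun α hα => ⟨0, by
      rintro _ ⟨g, rfl⟩
      exact Finset.sum_nonneg fun x _ => mul_nonneg (hα.1.1 x) (g.2.1 x)⟩) fun f =>
      (show Continuous fun α : X → ℝ => α ⬝ᵥ f.1 by
        unfold dotProduct; fun_prop).upperSemicontinuous.upperSemicontinuousOn _
  obtain ⟨μ, hμ, hmax⟩ := husc.exists_isMaxOn ⟨α, hα⟩ isCompact_undecided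
  refine (hmax hα).trans (not_lt.1 fun hv => ?_)
  have h0 : val P W L μ ≤ 0 := by
    refine (val_le hμ.1.1 h.indicator_mem_bounds).trans
      (Finset.sum_eq_zero fun x _ => ?_).le
    by_cases hx : μ x = 0
    · simp [hx]
    rw [Set.indicator_of_notMem, mul_zero]
    rintro ⟨n, hn⟩
    have := (Finset.sum_eq_zero_iff_of_nonneg fun x _ => mul_nonneg (hμ.1.1 x)
      ((h.backwardIter_bounds _ n).2.1 x)).1
      (h.dotProduct_backwardIter_one hv (fun α hα => hmax hα) n hμ le_rfl) x (Finset.mem_univ x)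
    exact (mul_ne_zero hx hn.ne') this
  exact hv.not_ge h0

theorem exists_sequence (h : IsBlindControl P W L) {x : X} (hW : x ∉ W) (hL : x ∉ L) {ε : ℝ}
    (hε : 0 < ε) : ∃ b : ℕ → Fin 2, ∀ᶠ n in atTop,
      b n = 1 ∧ backwardIter (op P) b n (W.indicator 1) x ≤ ε := by
  classical
  have hmem : Pi.single x 1 ∈ undecided W L := by
    refine ⟨single_mem_stdSimplex ℝ x, fun y hy => ?_⟩
    rw [Pi.single_eq_of_ne]
    rintro rfl
    exact hy.elim hW hL
  have : Nonempty (bounds P W L) := ⟨⟨_, h.indicator_mem_bounds⟩⟩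
  obtain ⟨f, hf⟩ := exists_lt_of_ciInf_lt ((h.val_nonpos hmem).trans_lt hε)
  obtain ⟨b, hb⟩ := f.2.2.2
  refine ⟨b, hb.mono fun n hn => ⟨hn.1, (hn.2 x).trans ?_⟩⟩
  rw [single_dotProduct, one_mul] at hf
  exact hf.le

end IsBlindControl

end BlindControl
-- Expectations under mass functions.
/-- The expectation of a nonnegative function under a probability mass function. -/
noncomputable def PMF.lexp {α : Type*} (p : PMF α) (f : α → ℝ≥0∞) : ℝ≥0∞ := ∑' a, p a * f a

namespace PMF

variable {α β : Type*}

theorem lexp_bind (p : PMF α) (q : α → PMF β) (f : β → ℝ≥0∞) :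
    (p.bind q).lexp f = p.lexp fun a => (q a).lexp f := by
  simp only [lexp, bind_apply, ← ENNReal.tsum_mul_right, ← ENNReal.tsum_mul_left, mul_assoc]
  exact ENNReal.tsum_comm

theorem lexp_pure (a : α) (f : α → ℝ≥0∞) : (PMF.pure a).lexp f = f a := by
  classical
  rw [lexp, tsum_eq_single a fun b hb => by simp [hb]]
  simp

theorem lexp_const (p : PMF α) (c : ℝ≥0∞) : (p.lexp fun _ => c) = c := by
  simp [lexp, ENNReal.tsum_mul_right]

theorem lexp_zero (p : PMF α) : (p.lexp fun _ => 0) = 0 := p.lexp_const 0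

theorem lintegral_toMeasure [Countable α] [MeasurableSpace α] [DiscreteMeasurableSpace α]
    (p : PMF α) (f : α → ℝ≥0∞) : ∫⁻ a, f a ∂p.toMeasure = p.lexp f := by
  rw [lintegral_countable' f]
  refine tsum_congr fun a => ?_
  rw [p.toMeasure_apply_singleton a (.of_discrete), mul_comm]

theorem lexp_ofReal [Fintype α] (p : PMF α) {f : α → ℝ} (hf : ∀ a, 0 ≤ f a) :
    (p.lexp fun a => ENNReal.ofReal (f a)) = ENNReal.ofReal (∑ a, (p a).toReal * f a) := by
  rw [lexp, tsum_fintype,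
    ENNReal.ofReal_sum_of_nonneg fun a _ => mul_nonneg ENNReal.toReal_nonneg (hf a)]
  refine Finset.sum_congr rfl fun a _ => ?_
  rw [ENNReal.ofReal_mul ENNReal.toReal_nonneg, ENNReal.ofReal_toReal (p.apply_ne_top a)]

end PMF

/-! ### One-step disintegration of the Ionescu-Tulcea measure. -/

namespace ConcurrentGame

variable {M S A B : Type*} [Countable M] [Countable S] [Countable A] [Countable B]

theorem lintegral_memoryLaw_zero (G : ConcurrentGame S A B) (s₀ : S)
    (σ : MemoryStrategy M S A B) (π : MinStrategy S A B) (f : MemoryStep M S A B → ℝ≥0∞) :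
    ∫⁻ x, f (x 0) ∂memoryLaw G s₀ σ π = (drawActions σ π 0 Fin.elim0 σ.init s₀).lexp f := by
  have hmap : (memoryLaw G s₀ σ π).map (Preorder.frestrictLe 0) =
      ((drawActions σ π 0 Fin.elim0 σ.init s₀).toMeasure).map
        (MeasurableEquiv.piUnique fun _ : Finset.Iic 0 => MemoryStep M S A B).symm := by
    rw [memoryLaw, Kernel.trajMeasure, Measure.map_comp _ _ (by fun_prop),
      Kernel.traj_map_frestrictLe, Kernel.partialTraj_self]
    exact Measure.id_comp
  have h0 : Measurable fun y : (i : Finset.Iic 0) → MemoryStep M S A B =>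
      f (y ⟨0, Finset.mem_Iic.2 le_rfl⟩) :=
    (Measurable.of_discrete (f := f)).comp (measurable_pi_apply _)
  rw [← PMF.lintegral_toMeasure]
  calc ∫⁻ x, f (x 0) ∂memoryLaw G s₀ σ π
      = ∫⁻ y, f (y ⟨0, Finset.mem_Iic.2 le_rfl⟩)
          ∂(memoryLaw G s₀ σ π).map (Preorder.frestrictLe 0) := by
        rw [lintegral_map h0 (by fun_prop)]; rfl
    _ = _ := by
        rw [hmap, lintegral_map h0 (MeasurableEquiv.measurable _)]; rfl

theorem lintegral_memoryLaw_succ (G : ConcurrentGame S A B) (s₀ : S)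
    (σ : MemoryStrategy M S A B) (π : MinStrategy S A B) (n : ℕ)
    (F : MemoryStep M S A B → MemoryStep M S A B → ℝ≥0∞) :
    ∫⁻ x, F (x n) (x (n + 1)) ∂memoryLaw G s₀ σ π =
      ∫⁻ x, (nextStep G σ π n (Preorder.frestrictLe n x)).lexp (F (x n)) ∂memoryLaw G s₀ σ π := by
  have hF : Measurable fun p : ((i : Finset.Iic n) → MemoryStep M S A B) × MemoryStep M S A B =>
      F (p.1 ⟨n, Finset.mem_Iic.2 le_rfl⟩) p.2 := by
    have hp : Measurable fun p : ((i : Finset.Iic n) → MemoryStep M S A B) × MemoryStep M S A B =>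
        (p.1 ⟨n, Finset.mem_Iic.2 le_rfl⟩, p.2) := by fun_prop
    exact (Measurable.of_discrete (f := fun q : MemoryStep M S A B × MemoryStep M S A B =>
      F q.1 q.2)).comp hp
  have key : (memoryLaw G s₀ σ π).map (Preorder.frestrictLe n) ⊗ₘ stepKernel G σ π n =
      (memoryLaw G s₀ σ π).map fun x => (Preorder.frestrictLe n x, x (n + 1)) :=
    Kernel.map_frestrictLe_trajMeasure_compProd_eq_map_trajMeasure
  calc ∫⁻ x, F (x n) (x (n + 1)) ∂memoryLaw G s₀ σ π
      = ∫⁻ p, F (p.1 ⟨n, Finset.mem_Iic.2 le_rfl⟩) p.2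
          ∂(memoryLaw G s₀ σ π).map fun x => (Preorder.frestrictLe n x, x (n + 1)) := by
        rw [lintegral_map hF (by fun_prop)]; rfl
    _ = _ := by
        rw [← key, Measure.lintegral_compProd hF, lintegral_map hF.lintegral_kernel_prod_right'
          (by fun_prop)]
        exact lintegral_congr fun x => PMF.lintegral_toMeasure _ _

end ConcurrentGame

/-! ### The Bad Match as a blind control problem. -/

namespace BadMatch

open BadMatchState ConcurrentGame

variable {M : Type*} (σ : MemoryStrategy M BadMatchState (Fin 2) (Fin 2))

/-- The Min strategy that plays the sequence `b`, whatever happens. -/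
noncomputable def blind (b : ℕ → Fin 2) : MinStrategy BadMatchState (Fin 2) (Fin 2) :=
  fun n _ _ => PMF.pure (b n)

/-- The law of the next memory mode and state after a step. -/
noncomputable def afterStep (y : MemoryStep M BadMatchState (Fin 2) (Fin 2)) :
    PMF (M × BadMatchState) :=
  (σ.update y.state y.mode y.actMax y.actMin (y.state.next y.actMax y.actMin)).bind fun m =>
    PMF.pure (m, y.state.next y.actMax y.actMin)

/-- The law of the next memory mode and state when Min plays `β`. -/
noncomputable def transition (β : Fin 2) (x : M × BadMatchState) : PMF (M × BadMatchState) :=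
  (σ.act x.1 x.2).bind fun a => afterStep σ ⟨x.1, x.2, a, β⟩

theorem lexp_nextStep (b : ℕ → Fin 2) (n : ℕ)
    (x : (i : Finset.Iic n) → MemoryStep M BadMatchState (Fin 2) (Fin 2))
    (f : MemoryStep M BadMatchState (Fin 2) (Fin 2) → ℝ≥0∞) :
    (nextStep badMatch σ (blind b) n x).lexp f =
      (afterStep σ (x ⟨n, Finset.mem_Iic.2 le_rfl⟩)).lexp fun z =>
        (σ.act z.1 z.2).lexp fun a => f ⟨z.1, z.2, a, b (n + 1)⟩ := by
  simp only [nextStep, badMatch, drawActions, blind, afterStep, PMF.lexp_bind, PMF.lexp_pure]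

/-- Step `n` already uses the bit `b n`, hence `n + 1` iterations. Time adds the last bit, whereas
`backwardIter` unfolds the first; `backwardIter_succ_last` reconciles the two. -/
theorem lintegral_afterStep [Countable M] (s₀ : BadMatchState) (b : ℕ → Fin 2) (n : ℕ)
    (g : M × BadMatchState → ℝ≥0∞) :
    ∫⁻ x, (afterStep σ (x n)).lexp g ∂memoryLaw badMatch s₀ σ (blind b) =
      backwardIter (fun β f x => (transition σ β x).lexp f) b (n + 1) g (σ.init, s₀) := by
  induction n generalizing g with
  | zero =>
    rw [lintegral_memoryLaw_zero _ _ _ _ fun y => (afterStep σ y).lexp g]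
    simp only [drawActions, blind, backwardIter, transition, PMF.lexp_bind, PMF.lexp_pure]
  | succ n ih =>
    rw [backwardIter_succ_last, ← ih,
      lintegral_memoryLaw_succ _ _ _ _ n fun _ y => (afterStep σ y).lexp g]
    refine lintegral_congr fun x => ?_
    rw [lexp_nextStep]
    simp only [transition, PMF.lexp_bind]
    rfl

theorem lintegral_mode_state [Countable M] (s₀ : BadMatchState) (b : ℕ → Fin 2) (n : ℕ)
    (g : M × BadMatchState → ℝ≥0∞) :
    ∫⁻ x, g ((x (n + 1)).mode, (x (n + 1)).state) ∂memoryLaw badMatch s₀ σ (blind b) =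
      backwardIter (fun β f x => (transition σ β x).lexp f) b (n + 1) g (σ.init, s₀) := by
  rw [← lintegral_afterStep, lintegral_memoryLaw_succ _ _ _ _ n fun _ y => g (y.mode, y.state)]
  refine lintegral_congr fun x => ?_
  rw [lexp_nextStep]
  simp only [PMF.lexp_const]
  rfl

theorem ae_next [Countable M] (s₀ : BadMatchState) (b : ℕ → Fin 2) :
    ∀ᵐ x ∂memoryLaw badMatch s₀ σ (blind b), ∀ n, (x (n + 1)).actMin = b (n + 1) ∧
      (x (n + 1)).state = (x n).state.next (x n).actMax (x n).actMin := by
  classical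
  refine ae_all_iff.2 fun n => ?_
  set D : Set (MemoryStep M BadMatchState (Fin 2) (Fin 2) ×
      MemoryStep M BadMatchState (Fin 2) (Fin 2)) :=
    {q | ¬ (q.2.actMin = b (n + 1) ∧ q.2.state = q.1.state.next q.1.actMax q.1.actMin)} with hD
  have hm : Measurable fun x : ℕ → MemoryStep M BadMatchState (Fin 2) (Fin 2) =>
      (x n, x (n + 1)) := by fun_prop
  have h : ∫⁻ x, D.indicator 1 (x n, x (n + 1)) ∂memoryLaw badMatch s₀ σ (blind b) = 0 := by
    rw [lintegral_memoryLaw_succ _ _ _ _ n fun y z => D.indicator 1 (y, z)]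
    simp only [lexp_nextStep, afterStep, PMF.lexp_bind, PMF.lexp_pure]
    simp [hD, Preorder.frestrictLe, PMF.lexp_zero]
  replace h := (lintegral_eq_zero_iff
    ((Measurable.of_discrete (f := D.indicator (fun _ => (1 : ℝ≥0∞)))).comp hm)).1 h
  filter_upwards [h] with x hx
  by_contra hc
  have : (x n, x (n + 1)) ∈ D := hc
  simp [this] at hx

theorem next_zero_ne_w {q : BadMatchState} (hq : q ≠ w) (a : Fin 2) : q.next a 0 ≠ w := by
  cases q <;> fin_cases a <;> simp_all [next]

theorem next_one_ne_s (q : BadMatchState) (a : Fin 2) : q.next a 1 ≠ s := by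
  cases q <;> fin_cases a <;> simp [next]

theorem next_zero_eq_l {q : BadMatchState} (hq : q ≠ w) {a : Fin 2} (h : q.next a 1 = w) :
    q.next a 0 = l := by
  cases q <;> fin_cases a <;> simp_all [next]

theorem transition_ne_zero_iff (β : Fin 2) (x y : M × BadMatchState) :
    transition σ β x y ≠ 0 ↔ ∃ a, σ.act x.1 x.2 a ≠ 0 ∧ x.2.next a β = y.2 ∧
      σ.update x.2 x.1 a β (x.2.next a β) y.1 ≠ 0 := by
  obtain ⟨m, q⟩ := y
  simp only [← PMF.mem_support_iff, transition, afterStep, PMF.mem_support_bind_iff,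
    PMF.mem_support_pure_iff, Prod.mk.injEq]
  constructor
  · rintro ⟨a, ha, m', hm, rfl, rfl⟩
    exact ⟨a, ha, rfl, hm⟩
  · rintro ⟨a, ha, rfl, hm⟩
    exact ⟨a, ha, m, hm, rfl, rfl⟩

theorem isBlindControl [Fintype M] [Fintype BadMatchState] :
    BlindControl.IsBlindControl
      (fun β => Matrix.of fun x y => (transition σ β x y).toReal) {x | x.2 = w} {x | x.2 = l} where
  nonneg _ _ _ := ENNReal.toReal_nonneg
  sum_eq_one β x := by
    simp only [Matrix.of_apply]
    rw [← ENNReal.toReal_sum fun y _ => PMF.apply_ne_top _ y, ← tsum_fintype (L := .unconditional _),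
      PMF.tsum_coe, ENNReal.toReal_one]
  disjoint x hx hw := by
    rw [Set.mem_ofPred_eq] at hx hw
    simp [hx] at hw
  absorbing β x hx y hy := by
    rw [Matrix.of_apply, ENNReal.toReal_eq_zero_iff]
    refine .inl (not_not.1 fun h => hy ?_)
    obtain ⟨a, -, h, -⟩ := (transition_ne_zero_iff σ β x y).1 h
    rw [Set.mem_ofPred_eq] at hx ⊢
    rw [← h, hx]
    rfl
  zero_avoids x hx y hy := by
    rw [Matrix.of_apply, ENNReal.toReal_eq_zero_iff]
    refine .inl (not_not.1 fun h => ?_)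
    obtain ⟨a, -, h, -⟩ := (transition_ne_zero_iff σ 0 x y).1 h
    exact next_zero_ne_w hx a (h.trans hy)
  one_avoids x hx _ h0 y hy := by
    rw [Matrix.of_apply, ENNReal.toReal_eq_zero_iff]
    refine .inl (not_not.1 fun h => ?_)
    obtain ⟨a, ha, h, -⟩ := (transition_ne_zero_iff σ 1 x y).1 h
    have hl := next_zero_eq_l hx (h.trans hy)
    -- The Max action that reaches `w` against 1 reaches `l` against 0, with any mode `m` that the
    -- update allows.
    obtain ⟨m, hm⟩ := (σ.update x.2 x.1 a 0 (x.2.next a 0)).support_nonempty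
    have := h0 (m, l) rfl
    rw [Matrix.of_apply, ENNReal.toReal_eq_zero_iff] at this
    exact this.elim ((transition_ne_zero_iff σ 0 x _).2 ⟨a, ha, hl, hm⟩) (PMF.apply_ne_top _ _)

/-- Links the measures, valued in `ℝ≥0∞`, to the real-valued compactness argument. -/
theorem backwardIter_ofReal [Fintype M] [Fintype BadMatchState] (b : ℕ → Fin 2) (n : ℕ)
    (x : M × BadMatchState) :
    backwardIter (fun β f x => (transition σ β x).lexp f) b n ({x | x.2 = w}.indicator 1) x =
      ENNReal.ofReal (backwardIter (BlindControl.op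
        fun β => Matrix.of fun x y => (transition σ β x y).toReal) b n
          ({x | x.2 = w}.indicator 1) x) := by
  classical
  induction n generalizing b x with
  | zero =>
    simp only [backwardIter, Set.indicator_apply]
    split_ifs <;> simp
  | succ n ih =>
    simp only [backwardIter]
    rw [funext (ih fun k => b (k + 1)),
      PMF.lexp_ofReal _ ((isBlindControl σ).backwardIter_bounds _ n).2.1]
    rfl

theorem measurableSet_buchi (T : Set BadMatchState) :
    MeasurableSet (buchi T : Set (Play BadMatchState (Fin 2) (Fin 2))) := by
  have : (buchi T : Set (Play BadMatchState (Fin 2) (Fin 2))) =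
      ⋂ N, ⋃ n, ⋃ _ : n ≥ N, {ω | (ω n).1 ∈ T} := by
    ext ω; simp [buchi, frequently_atTop]
  rw [this]
  refine .iInter fun N => .iUnion fun n => .iUnion fun _ => ?_
  exact (measurable_fst.comp (measurable_pi_apply n)) (.of_discrete (s := T))

theorem eventually_w_of_buchi {b : ℕ → Fin 2} (hb : ∀ᶠ n in atTop, b n = 1)
    {x : ℕ → MemoryStep M BadMatchState (Fin 2) (Fin 2)}
    (hx : ∀ n, (x (n + 1)).actMin = b (n + 1) ∧
      (x (n + 1)).state = (x n).state.next (x n).actMax (x n).actMin)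
    (hB : ∃ᶠ n in atTop, (x n).state = BadMatchState.s ∨ (x n).state = w) :
    ∃ N, ∀ n ≥ N, (x n).state = w := by
  obtain ⟨N, hN⟩ := eventually_atTop.1 hb
  -- The state at `k + 2` depends on Min's action at `k + 1`, which `hx` ties to `b` because the
  -- index is positive.
  obtain ⟨n, hn, hs⟩ := frequently_atTop.1 hB (N + 2)
  obtain ⟨k, rfl⟩ : ∃ k, n = k + 2 := ⟨n - 2, by lia⟩
  refine ⟨k + 2, fun j hj => ?_⟩
  induction j, hj using Nat.le_induction with
  | base =>
    refine hs.resolve_left fun h => next_one_ne_s (x (k + 1)).state (x (k + 1)).actMax ?_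
    rw [← h, (hx (k + 1)).2, (hx k).1, hN (k + 1) (by lia)]
  | succ j _ ih => rw [(hx j).2, ih]; rfl

theorem measure_buchi_le [Countable M] (s₀ : BadMatchState) {b : ℕ → Fin 2} {ε : ℝ≥0∞}
    (hb : ∀ᶠ n in atTop, b n = 1) (hε : ∀ᶠ n in atTop,
      backwardIter (fun β f x => (transition σ β x).lexp f) b n ({x | x.2 = w}.indicator 1)
        (σ.init, s₀) ≤ ε) :
    badMatch.playLaw s₀ σ (blind b) (buchi {BadMatchState.s, w}) ≤ ε := by
  classical
  rw [playLaw, Measure.map_apply MemoryStep.measurable_forget (measurableSet_buchi _)]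
  calc _ ≤ memoryLaw badMatch s₀ σ (blind b) (⋃ N, {x | ∀ n ≥ N, (x n).state = w}) := by
        refine measure_mono_ae ?_
        filter_upwards [ae_next σ s₀ b] with x hx hB
        exact Set.mem_iUnion.2 (eventually_w_of_buchi hb hx hB)
    _ ≤ ε := by
        -- The events of staying in `w` from `N` on increase with `N`, and each implies being in `w`
        -- at a single late time, where `hε` applies.
        rw [Monotone.measure_iUnion fun i j hij => Set.ofPred_subset_ofPred.2 fun x hx n hn =>
          hx n (hij.trans hn)]
        refine iSup_le fun N => ?_
        obtain ⟨n, hn, hnN⟩ := (((tendsto_add_atTop_nat 1).eventually hε).and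
          (eventually_ge_atTop N)).exists
        rw [← lintegral_mode_state] at hn
        refine le_trans ?_ hn
        have hm : MeasurableSet {x : ℕ → MemoryStep M BadMatchState (Fin 2) (Fin 2) |
            (x (n + 1)).state = w} :=
          (measurable_pi_apply (n + 1) : Measurable fun x :
            ℕ → MemoryStep M BadMatchState (Fin 2) (Fin 2) => x (n + 1))
            (.of_discrete (s := {y : MemoryStep M BadMatchState (Fin 2) (Fin 2) | y.state = w}))
        calc _ ≤ memoryLaw badMatch s₀ σ (blind b) {x | (x (n + 1)).state = w} :=
              measure_mono (Set.ofPred_subset_ofPred.2 fun x hx => hx (n + 1) (by lia))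
          _ = _ := by
              rw [← lintegral_indicator_one hm]
              rfl

end BadMatch

theorem mainTheorem6 {M : Type*} [Finite M]
    (σ : MemoryStrategy M BadMatchState (Fin 2) (Fin 2)) :
    ⨅ π : MinStrategy BadMatchState (Fin 2) (Fin 2),
      badMatch.playLaw BadMatchState.d σ π (buchi {BadMatchState.s, BadMatchState.w}) = 0 := by
  classical
  have := Fintype.ofFinite M
  have : Fintype BadMatchState := ⟨{.d, .w, .l, .s, .t}, fun x => by cases x <;> simp⟩
  refine le_antisymm (ENNReal.le_of_forall_pos_le_add fun ε hε _ => ?_) zero_le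
  obtain ⟨b, hb⟩ := (BadMatch.isBlindControl σ).exists_sequence
    (x := (σ.init, BadMatchState.d)) (by simp) (by simp) (NNReal.coe_pos.2 hε)
  refine (iInf_le _ (BadMatch.blind b)).trans ?_
  rw [zero_add]
  refine BadMatch.measure_buchi_le σ _ (hb.mono fun n hn => hn.1) (hb.mono fun n hn => ?_)
  rw [BadMatch.backwardIter_ofReal]
  exact (ENNReal.ofReal_le_ofReal hn.2).trans_eq ENNReal.ofReal_coe_nnreal
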